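/- Let $\mathbf H_4$ be the Hecke group, i.e. the subgroup of $\mathrm{PSL}_2(\mathbb R)$ generated by $\begin{pmatrix}1&\sqrt2\\0&1\end{pmatrix}$ and $\begin{pmatrix}0&-1\\1&0\end{pmatrix}$. Write $p/q\in\mathbb Q(\mathbf H_4)$ if $q>0$ and $\begin{pmatrix}p&r\\q&s\end{pmatrix}\in\mathbf H_4$ for some real $r,s$; as a set of real numbers, $\mathbb Q(\mathbf H_4)=\sqrt2\,\mathbb Q$. A fraction $p/q\in\mathbb Q(\mathbf H_4)$ is an $\mathbf H_4$-best approximation of a real number $\alpha$ if $|s\alpha-r|>|q\alpha-p|$ for every $r/s\in\mathbb Q(\mathbf H_4)$ with $r/s\ne p/q$ and $0<s\le q$. For integers $a_k$ and signs $\epsilon_k\in\{-1,+1\}$ put $$[\![a_0;\epsilon_1/a_1,\dots,\epsilon_i/a_i]\!]=a_0\sqrt2+\cfrac{\epsilon_1}{a_1\sqrt2+\cfrac{\epsilon_2}{\ddots+\cfrac{\epsilon_i}{a_i\sqrt2}}}.$$ For $x\in\mathbb R\setminus\mathbb Q(\mathbf H_4)$ let $a(x)$ be the integer with $a(x)\sqrt2-\frac1{\sqrt2}<x<a(x)\sqrt2+\frac1{\sqrt2}$,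 and let $\tilde a(x)$ be the integer with $(\tilde a(x)-1)\sqrt2+1\le x<\tilde a(x)\sqrt2+1$. Put $f(x)=1/|x-a(x)\sqrt2|$ and $\tilde f(x)=1/|x-\tilde a(x)\sqrt2|$. The Rosen continued fraction of $\alpha\in\mathbb R\setminus\mathbb Q(\mathbf H_4)$ has, for $i\ge0$, the digits $a_i=a(f^i(\alpha))$ and the signs $\epsilon_{i+1}=\operatorname{sgn}\bigl(f^i(\alpha)-a_i\sqrt2\bigr)$; the dual Rosen continued fraction of $\alpha$ has the digits $\tilde a_i=\tilde a(\tilde f^i(\alpha))$ and the signs $\tilde\epsilon_{i+1}=\operatorname{sgn}\bigl(\tilde f^i(\alpha)-\tilde a_i\sqrt2\bigr)$. Their $i$-th convergents are $\frac{r_i}{s_i}=[\![a_0;\epsilon_1/a_1,\dots,\epsilon_i/a_i]\!]$ and $\frac{\tilde r_i}{\tilde s_i}=[\![\tilde a_0;\tilde\epsilon_1/\tilde a_1,\dots,\tilde\epsilon_i/\tilde a_i]\!]$. **Theorem.** Let $\alpha$ be a real number not in $\mathbb Q(\mathbf H_4)$. Then $p/q\in\mathbb Q(\mathbf H_4)$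 is an $\mathbf H_4$-best approximation of $\alpha$ if and only if $\frac pq=\frac{r_i}{s_i}$ for some $i\ge0$ or $\frac pq=\frac{\tilde r_i}{\tilde s_i}$ for some $i\ge1$. -/

import Mathlib

namespace Hecke4

noncomputable section

/-- The translation `x ↦ x + √2`. -/
def T : Matrix.SpecialLinearGroup (Fin 2) ℝ :=
  ⟨!![1, Real.sqrt 2; 0, 1], by simp⟩

/-- The inversion `x ↦ -1 / x`. -/
def S : Matrix.SpecialLinearGroup (Fin 2) ℝ :=
  ⟨!![0, -1; 1, 0], by simp⟩

/-- The Hecke group `H₄`, as the group of matrices generated by `T` and `S`. It contains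
`-1 = S * S` (see `neg_one_mem_H4`), so it is the full preimage in `SL₂(ℝ)` of the subgroup of
`PSL₂(ℝ)` generated by the classes of `T` and `S`. -/
def H4 : Subgroup (Matrix.SpecialLinearGroup (Fin 2) ℝ) :=
  Subgroup.closure {T, S}

theorem neg_one_mem_H4 : (-1 : Matrix.SpecialLinearGroup (Fin 2) ℝ) ∈ H4 := by
  have hS : S ∈ H4 := Subgroup.subset_closure (by simp)
  have h : S * S = -1 := by
    ext i j
    rw [Matrix.SpecialLinearGroup.coe_mul]
    fin_cases i <;> fin_cases j <;> simp [S]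
  exact h ▸ H4.mul_mem hS hS

/-- `p / q` is a (reduced) fraction of `ℚ(H₄)`: `q > 0` and `(p, q)` is the first column of a matrix
of `H₄`. The numbers `p` and `q` are determined by the real number `p / q`. -/
def IsFraction (p q : ℝ) : Prop :=
  0 < q ∧ ∃ g ∈ H4, g.1 0 0 = p ∧ g.1 1 0 = q

/-- The real points of `ℚ(H₄)`, the orbit of `∞` under `H₄`. -/
def QH4 : Set ℝ :=
  {x | ∃ p q : ℝ, IsFraction p q ∧ x = p / q}

/-- `p / q ∈ ℚ(H₄)` is an `H₄`-best approximation of `α`. -/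
def IsBestApprox (α p q : ℝ) : Prop :=
  IsFraction p q ∧
    ∀ r s : ℝ, IsFraction r s → r / s ≠ p / q → s ≤ q → |q * α - p| < |s * α - r|

/-- `finiteCF a ε i` is the finite continued fraction
`a₀ √2 + ε₀ / (a₁ √2 + ε₁ / (⋯ + ε_{i-1} / (a_i √2)))`. Here `ε k` is the sign standing above
`a (k + 1)`, the one usually numbered `k + 1`. -/
def finiteCF : (ℕ → ℤ) → (ℕ → ℝ) → ℕ → ℝ
  | a, _, 0 => a 0 * Real.sqrt 2
  | a, ε, i + 1 =>
      a 0 * Real.sqrt 2 + ε 0 / finiteCF (fun k => a (k + 1)) (fun k => ε (k + 1)) i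

/-- The first Rosen digit of `x`: the integer `a` with `a √2 - 1/√2 ≤ x < a √2 + 1/√2`
(the left end point lies in `ℚ(H₄)`, so it does not matter where it is put). -/
def rosenFirst (x : ℝ) : ℤ := ⌊x / Real.sqrt 2 + 1 / 2⌋

/-- The Rosen continued fraction map. -/
def rosenMap (x : ℝ) : ℝ := 1 / |x - rosenFirst x * Real.sqrt 2|

/-- The digits `a₀, a₁, a₂, …` of the Rosen continued fraction of `α`. -/
def rosenDigit (α : ℝ) (i : ℕ) : ℤ := rosenFirst (rosenMap^[i] α)

/-- The sign standing above the digit with index `i + 1` in the Rosen continued fraction of `α`. -/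
def rosenSign (α : ℝ) (i : ℕ) : ℝ :=
  Real.sign (rosenMap^[i] α - rosenDigit α i * Real.sqrt 2)

/-- The `i`-th convergent of the Rosen continued fraction of `α`. -/
def rosenConvergent (α : ℝ) (i : ℕ) : ℝ := finiteCF (rosenDigit α) (rosenSign α) i

/-- The first dual Rosen digit of `x`: the integer `a` with `(a - 1) √2 + 1 ≤ x < a √2 + 1`. -/
def dualFirst (x : ℝ) : ℤ := ⌊(x - 1) / Real.sqrt 2⌋ + 1

/-- The dual Rosen continued fraction map. -/
def dualMap (x : ℝ) : ℝ := 1 / |x - dualFirst x * Real.sqrt 2|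

/-- The digits of the dual Rosen continued fraction of `α`. -/
def dualDigit (α : ℝ) (i : ℕ) : ℤ := dualFirst (dualMap^[i] α)

/-- The sign standing above the digit with index `i + 1` in the dual Rosen continued fraction
of `α`. -/
def dualSign (α : ℝ) (i : ℕ) : ℝ :=
  Real.sign (dualMap^[i] α - dualDigit α i * Real.sqrt 2)

/-- The `i`-th convergent of the dual Rosen continued fraction of `α`. -/
def dualConvergent (α : ℝ) (i : ℕ) : ℝ := finiteCF (dualDigit α) (dualSign α) i

theorem rosenFirst_eq_iff (x : ℝ) (a : ℤ) :
    rosenFirst x = a ↔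
      a * Real.sqrt 2 - 1 / Real.sqrt 2 ≤ x ∧ x < a * Real.sqrt 2 + 1 / Real.sqrt 2 := by
  have h0 : (0 : ℝ) < Real.sqrt 2 := by positivity
  have h2 : 1 / Real.sqrt 2 = 1 / 2 * Real.sqrt 2 := by
    rw [div_eq_iff h0.ne', mul_assoc, Real.mul_self_sqrt (by norm_num)]
    norm_num
  have hx : x = x / Real.sqrt 2 * Real.sqrt 2 := by field_simp
  rw [rosenFirst, Int.floor_eq_iff, h2, ← sub_mul, ← add_mul, ← le_div_iff₀ h0, ← div_lt_iff₀ h0]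
  constructor <;> rintro ⟨h, h'⟩ <;> constructor <;> linarith

theorem dualFirst_eq_iff (x : ℝ) (a : ℤ) :
    dualFirst x = a ↔
      ((a : ℝ) - 1) * Real.sqrt 2 + 1 ≤ x ∧ x < a * Real.sqrt 2 + 1 := by
  have h0 : (0 : ℝ) < Real.sqrt 2 := by positivity
  rw [dualFirst, ← eq_sub_iff_add_eq, Int.floor_eq_iff, le_div_iff₀ h0, div_lt_iff₀ h0]
  push_cast
  rw [sub_add_cancel]
  constructor <;> rintro ⟨h, h'⟩ <;> constructor <;> linarith

end

end Hecke4

namespace Hecke4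

/-- `(p, q)` is the first column of a matrix of `H₄`. -/
def IsColumn (p q : ℝ) : Prop := ∃ g ∈ H4, g.1 0 0 = p ∧ g.1 1 0 = q

/-- `(p, q)` and `(p', q')` are, up to the sign of the second one, the columns of a matrix
of `H₄`. -/
def Neighbors (p q p' q' : ℝ) : Prop :=
  ∃ g ∈ H4, g.1 0 0 = p ∧ g.1 1 0 = q ∧
    ((g.1 0 1 = p' ∧ g.1 1 1 = q') ∨ (g.1 0 1 = -p' ∧ g.1 1 1 = -q'))

/-- One coordinate lies in `√2 ℤ` and the other one is an odd integer. -/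
def ColumnForm (a b : ℝ) : Prop :=
  (∃ m n : ℤ, a = 2 * m + 1 ∧ b = n * √2) ∨ (∃ m n : ℤ, a = m * √2 ∧ b = 2 * n + 1)

theorem sqrt_two_sq : √2 * √2 = (2 : ℝ) := Real.mul_self_sqrt (by norm_num)

theorem lt_sqrt_two : (1.41 : ℝ) < √2 := Real.lt_sqrt_of_sq_lt (by norm_num)

theorem sqrt_two_lt : √2 < (1.42 : ℝ) := (Real.sqrt_lt' (by norm_num)).2 (by norm_num)

theorem int_sqrt_two {m n : ℤ} (h : (m : ℝ) * √2 = n) : m = 0 := by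
  by_contra hm
  have hm' : (m : ℝ) ≠ 0 := by exact_mod_cast hm
  exact irrational_sqrt_two.ne_rat ((n : ℚ) / m) (by push_cast; field_simp; linarith)

theorem T_zpow_mem (n : ℤ) : T ^ n ∈ H4 :=
  H4.zpow_mem (Subgroup.subset_closure (by simp)) n

theorem S_mem : S ∈ H4 := Subgroup.subset_closure (by simp)

theorem T_pow_val (n : ℕ) : (T ^ n).1 = !![1, n * √2; 0, 1] := by
  induction n with
  | zero => ext i j; fin_cases i <;> fin_cases j <;> simp
  | succ n ih =>
    rw [pow_succ, Matrix.SpecialLinearGroup.coe_mul, ih]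
    ext i j
    fin_cases i <;> fin_cases j <;> simp [T, Matrix.mul_apply, Fin.sum_univ_two]
    ring

theorem T_zpow_val (n : ℤ) : (T ^ n).1 = !![1, n * √2; 0, 1] := by
  obtain ⟨k, rfl | rfl⟩ := n.eq_nat_or_neg
  · simpa using T_pow_val k
  · rw [zpow_neg, zpow_natCast, Matrix.SpecialLinearGroup.coe_inv, T_pow_val,
      Matrix.adjugate_fin_two]
    ext i j
    fin_cases i <;> fin_cases j <;> simp

theorem S_val : S.1 = !![0, -1; 1, 0] := rfl

theorem T_val : T.1 = !![1, √2; 0, 1] := rfl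

/-- Every matrix of `H₄` has one of the two shapes `(a, b√2; c√2, d)` and `(a√2, b; c, d√2)` with
integers `a, b, c, d`. -/
theorem H4_form {g : Matrix.SpecialLinearGroup (Fin 2) ℝ} (hg : g ∈ H4) :
    (∃ a b c d : ℤ, g.1 0 0 = a ∧ g.1 0 1 = b * √2 ∧ g.1 1 0 = c * √2 ∧ g.1 1 1 = d) ∨
    (∃ a b c d : ℤ, g.1 0 0 = a * √2 ∧ g.1 0 1 = b ∧ g.1 1 0 = c ∧ g.1 1 1 = d * √2) := by
  have h2 := sqrt_two_sq
  induction hg using Subgroup.closure_induction with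
  | mem x hx =>
    rcases hx with rfl | rfl
    · exact Or.inl ⟨1, 1, 0, 1, by simp [T]⟩
    · exact Or.inr ⟨0, -1, 1, 0, by simp [S]⟩
  | one => exact Or.inl ⟨1, 0, 0, 1, by simp⟩
  | mul x y _ _ hx hy =>
    simp only [Matrix.SpecialLinearGroup.coe_mul, Matrix.mul_apply, Fin.sum_univ_two]
    rcases hx with ⟨a, b, c, d, h1, h3, h4, h5⟩ | ⟨a, b, c, d, h1, h3, h4, h5⟩ <;>
    rcases hy with ⟨a', b', c', d', h1', h3', h4', h5'⟩ | ⟨a', b', c', d', h1', h3', h4', h5'⟩ <;>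
    rw [h1, h3, h4, h5, h1', h3', h4', h5']
    · refine Or.inl ⟨a * a' + 2 * b * c', a * b' + b * d', c * a' + d * c', 2 * c * b' + d * d',
        ?_, ?_, ?_, ?_⟩ <;> push_cast <;> ring_nf <;> (try simp only [Real.sq_sqrt (show (0 : ℝ) ≤ 2 by norm_num)]) <;> ring
    · refine Or.inr ⟨a * a' + b * c', a * b' + 2 * b * d', 2 * c * a' + d * c', c * b' + d * d',
        ?_, ?_, ?_, ?_⟩ <;> push_cast <;> ring_nf <;> (try simp only [Real.sq_sqrt (show (0 : ℝ) ≤ 2 by norm_num)]) <;> ring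
    · refine Or.inr ⟨a * a' + b * c', 2 * a * b' + b * d', c * a' + 2 * d * c', c * b' + d * d',
        ?_, ?_, ?_, ?_⟩ <;> push_cast <;> ring_nf <;> (try simp only [Real.sq_sqrt (show (0 : ℝ) ≤ 2 by norm_num)]) <;> ring
    · refine Or.inl ⟨2 * a * a' + b * c', a * b' + b * d', c * a' + d * c', c * b' + 2 * d * d',
        ?_, ?_, ?_, ?_⟩ <;> push_cast <;> ring_nf <;> (try simp only [Real.sq_sqrt (show (0 : ℝ) ≤ 2 by norm_num)]) <;> ring
  | inv x _ hx =>
    simp only [Matrix.SpecialLinearGroup.coe_inv, Matrix.adjugate_fin_two]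
    rcases hx with ⟨a, b, c, d, h1, h3, h4, h5⟩ | ⟨a, b, c, d, h1, h3, h4, h5⟩
    · exact Or.inl ⟨d, -b, -c, a, by simp [h1, h3, h4, h5]⟩
    · exact Or.inr ⟨d, -b, -c, a, by simp [h1, h3, h4, h5]⟩

/-- `H₄` is stable under conjugation by `diag(1, -1)`. -/
theorem H4_conj {g : Matrix.SpecialLinearGroup (Fin 2) ℝ} (hg : g ∈ H4) :
    ∃ h ∈ H4, h.1 0 0 = g.1 0 0 ∧ h.1 0 1 = -g.1 0 1 ∧ h.1 1 0 = -g.1 1 0 ∧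
      h.1 1 1 = g.1 1 1 := by
  induction hg using Subgroup.closure_induction with
  | mem x hx =>
    rcases hx with rfl | rfl
    · exact ⟨T ^ (-1 : ℤ), T_zpow_mem _, by simp only [T_zpow_val, T_val]; simp⟩
    · refine ⟨S⁻¹, H4.inv_mem S_mem, ?_⟩
      simp only [Matrix.SpecialLinearGroup.coe_inv, Matrix.adjugate_fin_two, S_val]
      simp
  | one => exact ⟨1, H4.one_mem, by simp⟩
  | mul x y _ _ hx hy =>
    obtain ⟨x', hx', h1, h2, h3, h4⟩ := hx
    obtain ⟨y', hy', k1, k2, k3, k4⟩ := hy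
    refine ⟨x' * y', H4.mul_mem hx' hy', ?_⟩
    simp only [Matrix.SpecialLinearGroup.coe_mul, Matrix.mul_apply, Fin.sum_univ_two, h1, h2, h3,
      h4, k1, k2, k3, k4]
    refine ⟨?_, ?_, ?_, ?_⟩ <;> ring
  | inv x _ hx =>
    obtain ⟨x', hx', h1, h2, h3, h4⟩ := hx
    refine ⟨x'⁻¹, H4.inv_mem hx', ?_⟩
    simp [Matrix.SpecialLinearGroup.coe_inv, Matrix.adjugate_fin_two, h1, h2, h3, h4]

theorem det_entries (g : Matrix.SpecialLinearGroup (Fin 2) ℝ) :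
    g.1 0 0 * g.1 1 1 - g.1 0 1 * g.1 1 0 = 1 := by
  have := g.2
  rwa [Matrix.det_fin_two] at this

theorem IsColumn.form {p q : ℝ} (h : IsColumn p q) : ColumnForm p q := by
  obtain ⟨g, hg, rfl, rfl⟩ := h
  have hd := det_entries g
  have h2 := sqrt_two_sq
  rcases H4_form hg with ⟨a, b, c, d, h1, h3, h4, h5⟩ | ⟨a, b, c, d, h1, h3, h4, h5⟩ <;>
    rw [h1, h3, h4, h5] at hd
  · have hd' : (a : ℝ) * d - 2 * (b * c) = 1 := by linear_combination hd + b * c * h2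
    have hd'' : a * d - 2 * (b * c) = 1 := by exact_mod_cast hd'
    rcases Int.even_or_odd' a with ⟨k, rfl | rfl⟩
    · have : 2 * (k * d - b * c) = 1 := by linear_combination hd''
      omega
    · exact Or.inl ⟨k, c, by rw [h1]; push_cast; ring, h4⟩
  · have hd' : 2 * ((a : ℝ) * d) - b * c = 1 := by linear_combination hd - a * d * h2
    have hd'' : 2 * (a * d) - b * c = 1 := by exact_mod_cast hd'
    rcases Int.even_or_odd' c with ⟨k, rfl | rfl⟩
    · have : 2 * (a * d - b * k) = 1 := by linear_combination hd''
      omega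
    · exact Or.inr ⟨a, k, h1, by rw [h4]; push_cast; ring⟩

theorem ColumnForm.neg_right {a b : ℝ} (h : ColumnForm a b) : ColumnForm a (-b) := by
  rcases h with ⟨m, n, rfl, rfl⟩ | ⟨m, n, rfl, rfl⟩
  · exact Or.inl ⟨m, -n, rfl, by push_cast; ring⟩
  · exact Or.inr ⟨m, -n - 1, rfl, by push_cast; ring⟩

theorem ColumnForm.neg {a b : ℝ} (h : ColumnForm a b) : ColumnForm (-a) (-b) := by
  rcases h with ⟨m, n, rfl, rfl⟩ | ⟨m, n, rfl, rfl⟩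
  · exact Or.inl ⟨-m - 1, -n, by push_cast; ring, by push_cast; ring⟩
  · exact Or.inr ⟨-m, -n - 1, by push_cast; ring, by push_cast; ring⟩

theorem IsColumn.neg_left {p q : ℝ} (h : IsColumn p q) : IsColumn (-p) q := by
  obtain ⟨g, hg, rfl, rfl⟩ := h
  obtain ⟨h, hh, h1, -, h3, -⟩ := H4_conj hg
  exact ⟨-1 * h, H4.mul_mem neg_one_mem_H4 hh, by simp [h1], by simp [h3]⟩

theorem IsColumn.neg {p q : ℝ} (h : IsColumn p q) : IsColumn (-p) (-q) := by
  obtain ⟨g, hg, rfl, rfl⟩ := h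
  exact ⟨-1 * g, H4.mul_mem neg_one_mem_H4 hg, by simp, by simp⟩

theorem IsColumn.inversion {p q : ℝ} (h : IsColumn p q) : IsColumn (-q) p := by
  obtain ⟨g, hg, rfl, rfl⟩ := h
  exact ⟨S * g, H4.mul_mem S_mem hg, by simp [S_val, Matrix.mul_apply, Fin.sum_univ_two],
    by simp [S_val, Matrix.mul_apply, Fin.sum_univ_two]⟩

theorem IsColumn.translate {p q : ℝ} (h : IsColumn p q) (n : ℤ) :
    IsColumn (p + n * √2 * q) q := by
  obtain ⟨g, hg, rfl, rfl⟩ := h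
  exact ⟨T ^ n * g, H4.mul_mem (T_zpow_mem n) hg,
    by simp [T_zpow_val, Matrix.mul_apply, Fin.sum_univ_two],
    by simp [T_zpow_val, Matrix.mul_apply, Fin.sum_univ_two]⟩

theorem isColumn_one_zero : IsColumn 1 0 := ⟨1, H4.one_mem, by simp, by simp⟩

theorem IsColumn.div_mem {p q : ℝ} (h : IsColumn p q) (hq : q ≠ 0) : p / q ∈ QH4 := by
  rcases hq.lt_or_gt with h0 | h0
  · exact ⟨-p, -q, ⟨by linarith, h.neg⟩, by rw [neg_div_neg_eq]⟩
  · exact ⟨p, q, ⟨h0, h⟩, rfl⟩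

theorem IsColumn.form_ne_zero {α p q : ℝ} (hα : α ∉ QH4) (h : IsColumn p q) :
    q * α - p ≠ 0 := by
  intro h0
  rcases eq_or_ne q 0 with rfl | hq
  · have hp : p = 0 := by linarith
    subst hp
    rcases h.form with ⟨m, n, h1, -⟩ | ⟨m, n, -, h1⟩
    · have : (0 : ℤ) = 2 * m + 1 := by exact_mod_cast h1
      omega
    · have : (0 : ℤ) = 2 * n + 1 := by exact_mod_cast h1
      omega
  · exact hα (by
      have : α = p / q := by rw [eq_div_iff hq]; linarith
      exact this ▸ h.div_mem hq)

theorem isColumn_int (n : ℤ) : IsColumn (n * √2) 1 := by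
  have := (isColumn_one_zero.inversion).translate n
  simpa using this

theorem ne_int_mul_sqrt_two {x : ℝ} (hx : x ∉ QH4) (n : ℤ) : x - n * √2 ≠ 0 := by
  simpa using (isColumn_int n).form_ne_zero hx

theorem one_div_abs_not_mem {x : ℝ} (hx : x ∉ QH4) (n : ℤ) : 1 / |x - n * √2| ∉ QH4 := by
  rintro ⟨p, q, ⟨hq, hpq⟩, h⟩
  change IsColumn p q at hpq
  have h0 := ne_int_mul_sqrt_two hx n
  have hp : 0 < p := by
    have : 0 < p / q := h ▸ by positivity
    exact (div_pos_iff_of_pos_right hq).1 this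
  have h1 : |x - n * √2| = q / p := by
    have : 0 < |x - n * √2| := by positivity
    field_simp at h ⊢
    linarith
  rcases abs_choice (x - n * √2) with h3 | h3 <;> rw [h3] at h1
  · refine hx ?_
    have := (hpq.inversion.neg_left.translate n).div_mem hp.ne'
    convert this using 1
    rw [add_div, neg_neg, mul_div_cancel_right₀ _ hp.ne']
    linarith
  · refine hx ?_
    have := (hpq.inversion.translate n).div_mem hp.ne'
    convert this using 1
    rw [add_div, neg_div, mul_div_cancel_right₀ _ hp.ne']
    linarith

theorem IsColumn.exists_neighbors {p q : ℝ} (h : IsColumn p q) : ∃ p' q', Neighbors p q p' q' := by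
  obtain ⟨g, hg, h1, h2⟩ := h
  exact ⟨_, _, g, hg, h1, h2, Or.inl ⟨rfl, rfl⟩⟩

namespace Neighbors

variable {p q p' q' : ℝ}

theorem isColumn (h : Neighbors p q p' q') : IsColumn p q := by
  obtain ⟨g, hg, h1, h2, -⟩ := h
  exact ⟨g, hg, h1, h2⟩

theorem neg_right (h : Neighbors p q p' q') : Neighbors p q (-p') (-q') := by
  obtain ⟨g, hg, h1, h2, h3⟩ := h
  exact ⟨g, hg, h1, h2, by simpa using h3.symm⟩

theorem neg_left (h : Neighbors p q p' q') : Neighbors (-p) (-q) p' q' := by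
  obtain ⟨g, hg, rfl, rfl, h3⟩ := h
  refine ⟨-1 * g, H4.mul_mem neg_one_mem_H4 hg, by simp, by simp, ?_⟩
  rcases h3 with ⟨h3, h4⟩ | ⟨h3, h4⟩ <;> simp [h3, h4]

theorem swap (h : Neighbors p q p' q') : Neighbors p' q' p q := by
  have key : ∀ {a b a' b' : ℝ} (g : Matrix.SpecialLinearGroup (Fin 2) ℝ), g ∈ H4 →
      g.1 0 0 = a → g.1 1 0 = b → g.1 0 1 = a' → g.1 1 1 = b' → Neighbors a' b' a b := by
    rintro _ _ _ _ g hg rfl rfl rfl rfl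
    exact ⟨g * S, H4.mul_mem hg S_mem, by simp [S_val, Matrix.mul_apply, Fin.sum_univ_two],
      by simp [S_val, Matrix.mul_apply, Fin.sum_univ_two],
      Or.inr (by simp [S_val, Matrix.mul_apply, Fin.sum_univ_two])⟩
  obtain ⟨g, hg, h1, h2, ⟨h3, h4⟩ | ⟨h3, h4⟩⟩ := h
  · exact key g hg h1 h2 h3 h4
  · simpa using (key g hg h1 h2 h3 h4).neg_left

theorem shear (h : Neighbors p q p' q') (n : ℤ) :
    Neighbors p q (p' + n * √2 * p) (q' + n * √2 * q) := by
  obtain ⟨g, hg, rfl, rfl, ⟨rfl, rfl⟩ | ⟨h3, h4⟩⟩ := h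
  · refine ⟨g * T ^ n, H4.mul_mem hg (T_zpow_mem n), ?_⟩
    simp only [Matrix.SpecialLinearGroup.coe_mul, T_zpow_val, Matrix.mul_apply, Fin.sum_univ_two]
    simp
    left
    constructor <;> ring
  · refine ⟨g * T ^ (-n), H4.mul_mem hg (T_zpow_mem _), ?_⟩
    simp only [Matrix.SpecialLinearGroup.coe_mul, T_zpow_val, Matrix.mul_apply, Fin.sum_univ_two]
    simp [h3, h4]
    right
    constructor <;> ring

theorem det (h : Neighbors p q p' q') : p * q' - p' * q = 1 ∨ p * q' - p' * q = -1 := by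
  obtain ⟨g, hg, rfl, rfl, ⟨rfl, rfl⟩ | ⟨h3, h4⟩⟩ := h
  · exact Or.inl (det_entries g)
  · have := det_entries g
    rw [h3, h4] at this
    exact Or.inr (by linarith)

theorem det_ne_zero (h : Neighbors p q p' q') : p * q' - p' * q ≠ 0 := by
  rcases h.det with h | h <;> rw [h] <;> norm_num

theorem coordinates (h : Neighbors p q p' q') {r s : ℝ} (hrs : IsColumn r s) :
    ∃ a b : ℝ, ColumnForm a b ∧ r = a * p + b * p' ∧ s = a * q + b * q' := by
  obtain ⟨g, hg, h1, h2, h3⟩ := h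
  obtain ⟨k, hk, rfl, rfl⟩ := hrs
  have hc : IsColumn ((g⁻¹ * k).1 0 0) ((g⁻¹ * k).1 1 0) :=
    ⟨_, H4.mul_mem (H4.inv_mem hg) hk, rfl, rfl⟩
  have hm : g * (g⁻¹ * k) = k := by group
  have e0 : k.1 0 0 = (g⁻¹ * k).1 0 0 * g.1 0 0 + (g⁻¹ * k).1 1 0 * g.1 0 1 := by
    conv_lhs => rw [← hm]
    rw [Matrix.SpecialLinearGroup.coe_mul g, Matrix.mul_apply, Fin.sum_univ_two]
    ring
  have e1 : k.1 1 0 = (g⁻¹ * k).1 0 0 * g.1 1 0 + (g⁻¹ * k).1 1 0 * g.1 1 1 := by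
    conv_lhs => rw [← hm]
    rw [Matrix.SpecialLinearGroup.coe_mul g, Matrix.mul_apply, Fin.sum_univ_two]
    ring
  rcases h3 with ⟨h3, h4⟩ | ⟨h3, h4⟩
  · exact ⟨_, _, hc.form, by rw [e0, h1, h3], by rw [e1, h2, h4]⟩
  · exact ⟨_, _, hc.form.neg_right, by rw [e0, h1, h3]; ring, by rw [e1, h2, h4]; ring⟩

/-- The neighbors of `(p, q)` are, up to sign, the translates of one of them by `√2 ℤ (p, q)`. -/
theorem unique (h : Neighbors p q p' q') {r s : ℝ} (h' : Neighbors p q r s) :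
    ∃ n : ℤ, (r = p' + n * √2 * p ∧ s = q' + n * √2 * q) ∨
      (r = -(p' + n * √2 * p) ∧ s = -(q' + n * √2 * q)) := by
  obtain ⟨a, b, hab, rfl, rfl⟩ := h.coordinates h'.swap.isColumn
  have hb : b = 1 ∨ b = -1 := by
    have e : p * (a * q + b * q') - (a * p + b * p') * q = b * (p * q' - p' * q) := by ring
    have := h'.det
    rw [e] at this
    rcases h.det with h | h <;> rw [h] at this <;> rcases this with h | h <;>
      first | (left; linarith) | (right; linarith)
  have ha : ∃ m : ℤ, a = m * √2 := by
    rcases hab with ⟨m, n, -, h1⟩ | ⟨m, n, h1, -⟩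
    · exfalso
      rcases hb with rfl | rfl
      · have := int_sqrt_two (m := n) (n := 1) (by push_cast; linarith)
        simp [this] at h1
      · have := int_sqrt_two (m := n) (n := -1) (by push_cast; linarith)
        simp [this] at h1
    · exact ⟨m, h1⟩
  obtain ⟨m, rfl⟩ := ha
  rcases hb with rfl | rfl
  · exact ⟨m, Or.inl ⟨by ring, by ring⟩⟩
  · exact ⟨-m, Or.inr ⟨by push_cast; ring, by push_cast; ring⟩⟩

theorem den_eq_zero (h : Neighbors p q p' q') (hq : 0 < q) (hq' : q' = 0) :
    q = 1 ∧ (p' = 1 ∨ p' = -1) ∧ ∃ m : ℤ, p = m * √2 := by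
  subst hq'
  have hd := h.det
  rcases h.swap.isColumn.form with ⟨k, l, h1, -⟩ | ⟨k, l, -, h1⟩
  swap
  · have : (0 : ℤ) = 2 * l + 1 := by exact_mod_cast h1
    omega
  have hd' : p' * q = 1 ∨ p' * q = -1 := by
    rcases hd with h | h
    · right; linarith
    · left; linarith
  rcases h.isColumn.form with ⟨m, n, h3, h4⟩ | ⟨m, n, h3, h4⟩
  · exfalso
    have hz : (2 * k + 1) * n = 0 := by
      rcases hd' with h | h
      · exact int_sqrt_two (n := 1) (by rw [h1, h4] at h; push_cast; linarith)
      · exact int_sqrt_two (n := -1) (by rw [h1, h4] at h; push_cast; linarith)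
    have hn : n = 0 := by
      rcases mul_eq_zero.1 hz with h | h
      · omega
      · exact h
    simp [h4, hn] at hq
  · have hpos : 0 < 2 * n + 1 := by
      have : (0 : ℝ) < ((2 * n + 1 : ℤ) : ℝ) := by push_cast; linarith
      exact_mod_cast this
    have hu : IsUnit (2 * n + 1) := by
      rcases hd' with h | h
      · refine IsUnit.of_mul_eq_one (2 * k + 1) ?_
        rw [h1, h4] at h
        have h5 : (2 * k + 1) * (2 * n + 1) = 1 := by exact_mod_cast h
        linarith
      · refine IsUnit.of_mul_eq_one (-(2 * k + 1)) ?_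
        rw [h1, h4] at h
        have h5 : (2 * k + 1) * (2 * n + 1) = -1 := by exact_mod_cast h
        linarith
    have hn : 2 * n + 1 = 1 := by
      rcases Int.isUnit_iff.1 hu with h | h
      · exact h
      · omega
    have hn0 : n = 0 := by omega
    have hq1 : q = 1 := by rw [h4, hn0]; simp
    exact ⟨hq1, by simpa [hq1] using hd', m, h3⟩

theorem den_ne (h : Neighbors p q p' q') : q ≠ q' := by
  rintro rfl
  have h0 : q ≠ 0 := by
    rintro rfl
    exact h.det_ne_zero (by ring)
  obtain ⟨g, hg, -, h2, h3⟩ := h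
  have h4 : g.1 1 1 = q ∨ g.1 1 1 = -q := by tauto
  rcases H4_form hg with ⟨a, b, c, d, -, -, h5, h6⟩ | ⟨a, b, c, d, -, -, h5, h6⟩
  · rw [h5] at h2
    rw [h6] at h4
    have hc : c = 0 := by
      rcases h4 with h | h
      · exact int_sqrt_two (n := d) (by rw [h2, h])
      · exact int_sqrt_two (n := -d) (by push_cast; rw [h2, h]; ring)
    simp [hc] at h2
    exact h0 h2.symm
  · rw [h5] at h2
    rw [h6] at h4
    have hd : d = 0 := by
      rcases h4 with h | h
      · exact int_sqrt_two (n := c) (by rw [h2, h])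
      · exact int_sqrt_two (n := -c) (by push_cast; rw [h2, h])
    simp [hd] at h4
    exact h0 (by simpa [eq_comm] using h4)

end Neighbors

theorem IsColumn.sq_nat {p q : ℝ} (h : IsColumn p q) : ∃ k : ℕ, q ^ 2 = k := by
  rcases h.form with ⟨m, n, -, rfl⟩ | ⟨m, n, -, rfl⟩
  · exact ⟨(2 * n ^ 2).toNat, by
      rw [← Int.cast_natCast, Int.toNat_of_nonneg (by positivity)]
      push_cast
      linear_combination (n : ℝ) ^ 2 * sqrt_two_sq⟩
  · exact ⟨((2 * n + 1) ^ 2).toNat, by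
      rw [← Int.cast_natCast, Int.toNat_of_nonneg (by positivity)]
      push_cast
      ring⟩

theorem IsFraction.den_le {p q r s : ℝ} (h : IsFraction p q) (h' : IsFraction r s)
    (e : p / q = r / s) : q ≤ s := by
  obtain ⟨hq, hpq⟩ := h
  obtain ⟨hs, hrs⟩ := h'
  obtain ⟨p', q', hn⟩ := IsColumn.exists_neighbors hpq
  obtain ⟨a, b, hab, rfl, rfl⟩ := hn.coordinates hrs
  rw [div_eq_div_iff hq.ne' hs.ne'] at e
  have hb : b = 0 := by
    have : b * (p * q' - p' * q) = 0 := by linear_combination e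
    exact (mul_eq_zero.1 this).resolve_right hn.det_ne_zero
  subst hb
  rcases hab with ⟨m, n, rfl, -⟩ | ⟨m, n, -, h1⟩
  · have h0 : (0 : ℝ) < 2 * m + 1 := by
      have : 0 < (2 * (m : ℝ) + 1) * q := by linarith
      exact pos_of_mul_pos_left this hq.le
    have h1 : 0 < 2 * m + 1 := by exact_mod_cast h0
    have h2 : (1 : ℝ) ≤ 2 * m + 1 := by exact_mod_cast h1
    nlinarith
  · have : (0 : ℤ) = 2 * n + 1 := by exact_mod_cast h1
    omega

theorem IsFraction.unique {p q r s : ℝ} (h : IsFraction p q) (h' : IsFraction r s)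
    (e : p / q = r / s) : p = r ∧ q = s := by
  have hqs : q = s := le_antisymm (h.den_le h' e) (h'.den_le h e.symm)
  subst hqs
  exact ⟨(div_left_inj' h.1.ne').1 e, rfl⟩

/-- The continued fraction map belonging to the digit function `d`. -/
noncomputable def cfMap (d : ℝ → ℤ) (x : ℝ) : ℝ := 1 / |x - d x * √2|

/-- The sign belonging to the digit function `d`. -/
noncomputable def cfSign (d : ℝ → ℤ) (x : ℝ) : ℝ := Real.sign (x - d x * √2)

/-- The `i`-th complete quotient of `α`. -/
noncomputable def quotient (d : ℝ → ℤ) (α : ℝ) (i : ℕ) : ℝ := (cfMap d)^[i] α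

/-- The numerators of the convergents, with index shifted by one. -/
noncomputable def cfNum (d : ℝ → ℤ) (α : ℝ) : ℕ → ℝ
  | 0 => 1
  | 1 => d α * √2
  | i + 2 => d (quotient d α (i + 1)) * √2 * cfNum d α (i + 1) +
      cfSign d (quotient d α i) * cfNum d α i

/-- The denominators of the convergents, with index shifted by one. -/
noncomputable def cfDen (d : ℝ → ℤ) (α : ℝ) : ℕ → ℝ
  | 0 => 0
  | 1 => 1
  | i + 2 => d (quotient d α (i + 1)) * √2 * cfDen d α (i + 1) +
      cfSign d (quotient d α i) * cfDen d α i

variable {d : ℝ → ℤ} {α : ℝ}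

theorem quotient_succ (i : ℕ) : quotient d α (i + 1) = cfMap d (quotient d α i) :=
  Function.iterate_succ_apply' _ _ _

theorem quotient_cfMap (i : ℕ) : quotient d (cfMap d α) i = quotient d α (i + 1) :=
  (Function.iterate_succ_apply _ _ _).symm

theorem quotient_not_mem (hα : α ∉ QH4) (i : ℕ) : quotient d α i ∉ QH4 := by
  induction i with
  | zero => exact hα
  | succ i ih => rw [quotient_succ]; exact one_div_abs_not_mem ih _

theorem cfSign_sq {x : ℝ} (hx : x ∉ QH4) : cfSign d x = 1 ∨ cfSign d x = -1 := by
  rcases (ne_int_mul_sqrt_two hx (d x)).lt_or_gt with h | h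
  · exact Or.inr (Real.sign_of_neg h)
  · exact Or.inl (Real.sign_of_pos h)

theorem cfDen_succ (i : ℕ) : cfDen d α (i + 1) = cfNum d (cfMap d α) i ∧
    cfDen d α (i + 2) = cfNum d (cfMap d α) (i + 1) := by
  induction i with
  | zero =>
    simp [cfDen, cfNum, quotient]
  | succ i ih =>
    refine ⟨ih.2, ?_⟩
    rw [cfDen, cfNum, ih.1, ih.2, quotient_cfMap, quotient_cfMap]

theorem cfNum_succ (i : ℕ) : cfNum d α (i + 1) = d α * √2 * cfNum d (cfMap d α) i +
      cfSign d α * cfDen d (cfMap d α) i ∧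
    cfNum d α (i + 2) = d α * √2 * cfNum d (cfMap d α) (i + 1) +
      cfSign d α * cfDen d (cfMap d α) (i + 1) := by
  induction i with
  | zero =>
    simp [cfDen, cfNum, quotient]
    ring
  | succ i ih =>
    refine ⟨ih.2, ?_⟩
    rw [cfNum, ih.1, ih.2, cfNum, cfDen, quotient_cfMap, quotient_cfMap]
    ring

theorem finiteCF_eq (hd : ∀ β ∉ QH4, ∀ i, 0 < cfDen d β (i + 1)) (i : ℕ) :
    ∀ α ∉ QH4, finiteCF (fun k => d (quotient d α k)) (fun k => cfSign d (quotient d α k)) i =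
      cfNum d α (i + 1) / cfDen d α (i + 1) := by
  induction i with
  | zero =>
    intro α _
    simp [finiteCF, cfNum, cfDen, quotient]
  | succ i ih =>
    intro α hα
    have hα' : cfMap d α ∉ QH4 := one_div_abs_not_mem hα _
    have h1 := ih _ hα'
    simp only [quotient_cfMap] at h1
    rw [finiteCF, h1, (cfNum_succ i).2, (cfDen_succ i).2]
    have h2 : 0 < cfNum d (cfMap d α) (i + 1) := (cfDen_succ (α := α) (d := d) i).2 ▸ hd α hα _
    have h3 := hd _ hα' i
    change d α * √2 + cfSign d α / _ = _
    field_simp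

/-- Consecutive convergents are neighbors, and the complete quotient is the ratio of their
distances to `α`. -/
theorem convergent_neighbors (hα : α ∉ QH4) (i : ℕ) :
    Neighbors (cfNum d α (i + 1)) (cfDen d α (i + 1)) (cfNum d α i) (cfDen d α i) ∧
    quotient d α (i + 1) * (cfDen d α (i + 1) * α - cfNum d α (i + 1)) +
      cfSign d (quotient d α i) * (cfDen d α i * α - cfNum d α i) = 0 := by
  have habs : ∀ t : ℝ, t ≠ 0 → 1 / |t| * t = Real.sign t := by
    intro t ht
    rcases ht.lt_or_gt with h | h
    · rw [Real.sign_of_neg h, abs_of_neg h]; field_simp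
    · rw [Real.sign_of_pos h, abs_of_pos h]; field_simp
  induction i with
  | zero =>
    constructor
    · refine Neighbors.swap ⟨T ^ d α, T_zpow_mem _, ?_⟩
      simp [T_zpow_val, cfNum, cfDen]
    · have h0 := ne_int_mul_sqrt_two hα (d α)
      rw [quotient_succ]
      have := habs _ h0
      simp only [quotient, Function.iterate_zero, id, cfMap, cfSign, cfDen, cfNum]
      linear_combination this
  | succ i ih =>
    obtain ⟨ih1, ih2⟩ := ih
    have ht := ne_int_mul_sqrt_two (quotient_not_mem (d := d) hα (i + 1))
      (d (quotient d α (i + 1)))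
    have hs := habs _ ht
    have he := cfSign_sq (d := d) (quotient_not_mem (d := d) hα i)
    constructor
    · rw [cfNum, cfDen]
      refine Neighbors.swap ?_
      have h1 := ih1.shear (d (quotient d α (i + 1)))
      have h2 := ih1.neg_right.shear (d (quotient d α (i + 1)))
      rcases he with he | he <;> rw [he]
      · convert h1 using 1 <;> ring
      · convert h2 using 1 <;> ring
    · rw [quotient_succ (i + 1)]
      rw [show cfSign d (quotient d α (i + 1)) = _ from hs.symm, cfNum, cfDen]
      have h3 : cfSign d (quotient d α i) * (cfDen d α i * α - cfNum d α i) =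
        - (quotient d α (i + 1) * (cfDen d α (i + 1) * α - cfNum d α (i + 1))) := by linarith
      rw [cfMap]
      linear_combination
        1 / |quotient d α (i + 1) - d (quotient d α (i + 1)) * √2| * h3

/-- No interval `[m√2 - 1, m√2 + 1]` or `[m√2, (m + 1)√2]` contains both numbers, and their
distance is more than one. -/
def Separated (l μ : ℝ) : Prop :=
  1 < |l - μ| ∧ (∀ m : ℤ, |m * √2 + μ| ≤ 1 → 1 < |m * √2 + l|) ∧
    ∀ m : ℤ, |2 * m + 1 + √2 * μ| ≤ 1 → 1 < |2 * m + 1 + √2 * l|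

theorem Separated.false_of_pos {l μ : ℝ} (hs : Separated l μ) {a b : ℝ} (hab : ColumnForm a b)
    (hb : 0 < b) (hL : |a + b * l| ≤ 1) (hQ : |a + b * μ| ≤ 1) : False := by
  obtain ⟨h1, h2, h3⟩ := hs
  have hb2 : b < 2 := by
    have e : b * (l - μ) = (a + b * l) - (a + b * μ) := by ring
    have h4 : |b * (l - μ)| ≤ 2 := by
      rw [e]
      exact (abs_sub _ _).trans (by linarith)
    rw [abs_mul, abs_of_pos hb] at h4
    nlinarith
  have hlt := lt_sqrt_two
  rcases hab with ⟨m, n, rfl, rfl⟩ | ⟨m, n, rfl, rfl⟩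
  · have hn : n = 1 := by
      have hn0 : (0 : ℝ) < n := pos_of_mul_pos_left hb (by positivity)
      have hn1 : (n : ℝ) < 2 := by nlinarith
      have : 0 < n := by exact_mod_cast hn0
      have : n < 2 := by exact_mod_cast hn1
      omega
    subst hn
    rw [Int.cast_one, one_mul] at hL hQ
    exact absurd hL (not_le.2 (h3 m hQ))
  · have hn : n = 0 := by
      have hn0 : 0 < 2 * n + 1 := by exact_mod_cast hb
      have hn1 : 2 * n + 1 < 2 := by exact_mod_cast hb2
      omega
    subst hn
    rw [Int.cast_zero, mul_zero, zero_add, one_mul] at hL hQ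
    exact absurd hL (not_le.2 (h2 m hQ))

theorem isBestApprox_of_separated {α p q p' q' l μ : ℝ} (h : Neighbors p q p' q') (hq : 0 < q)
    (h0 : q * α - p ≠ 0) (hμ : q' = μ * q) (hl : q' * α - p' = l * (q * α - p))
    (hs : Separated l μ) : IsBestApprox α p q := by
  refine ⟨⟨hq, h.isColumn⟩, fun r s ⟨hs0, hrs⟩ hne hsq => ?_⟩
  by_contra! hcon
  obtain ⟨a, b, hab, rfl, rfl⟩ := h.coordinates hrs
  have hL : |a + b * l| ≤ 1 := by
    have e : (a * q + b * q') * α - (a * p + b * p') = (a + b * l) * (q * α - p) := by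
      linear_combination b * hl
    rw [e, abs_mul] at hcon
    have := abs_pos.2 h0
    by_contra! hh
    nlinarith
  have hQ : |a + b * μ| ≤ 1 := by
    have e : a * q + b * q' = (a + b * μ) * q := by rw [hμ]; ring
    rw [e] at hs0 hsq
    rw [abs_le]
    constructor
    · have := pos_of_mul_pos_left hs0 hq.le
      linarith
    · by_contra! hh
      nlinarith
  rcases lt_trichotomy b 0 with hb | rfl | hb
  · refine hs.false_of_pos hab.neg (neg_pos.2 hb) ?_ ?_
    · rw [← abs_neg]; convert hL using 2; ring
    · rw [← abs_neg]; convert hQ using 2; ring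
  · refine hne ?_
    have ha : a ≠ 0 := by
      rintro rfl
      simp at hs0
    simp only [zero_mul, add_zero]
    exact mul_div_mul_left _ _ ha
  · exact hs.false_of_pos hab hb hL hQ

theorem separated_of {l μ : ℝ} (h0 : 0 ≤ μ) (h1 : μ < 1) (hl : 1 < |l|) (hlμ : 1 < |l - μ|)
    (h2 : √2 - 1 ≤ μ → 1 < |l - √2|) (h3 : 1 < |√2 * l - 1|) (h4 : μ = 0 → 1 < |√2 * l + 1|) :
    Separated l μ := by
  have hs1 := lt_sqrt_two
  have hs2 := sqrt_two_lt
  refine ⟨hlμ, fun m hm => ?_, fun m hm => ?_⟩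
  · rw [abs_le] at hm
    have hm1 : m < 1 := by
      by_contra! hh
      have : (1 : ℝ) ≤ m := by exact_mod_cast hh
      nlinarith
    have hm2 : -2 < m := by
      by_contra! hh
      have : (m : ℝ) ≤ -2 := by exact_mod_cast hh
      nlinarith
    obtain rfl | rfl : m = 0 ∨ m = -1 := by omega
    · simpa using hl
    · have := h2 (by push_cast at hm; linarith)
      convert this using 2
      push_cast
      ring
  · rw [abs_le] at hm
    have hμ2 : √2 * μ < 2 := by nlinarith
    have hμ0 : 0 ≤ √2 * μ := by positivity
    have hm1 : m < 1 := by
      by_contra! hh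
      have : (1 : ℝ) ≤ m := by exact_mod_cast hh
      linarith
    have hm2 : -2 < m := by
      by_contra! hh
      have : (m : ℝ) ≤ -2 := by exact_mod_cast hh
      linarith
    obtain rfl | rfl : m = 0 ∨ m = -1 := by omega
    · have hz : √2 * μ = 0 := by push_cast at hm; linarith
      have := h4 ((mul_eq_zero.1 hz).resolve_left (by positivity))
      convert this using 2
      push_cast
      ring
    · convert h3 using 2
      push_cast
      ring

theorem separated_rosen {l μ : ℝ} (h0 : 0 ≤ μ) (h1 : μ < 1)
    (hl : l < -√2 ∨ (√2 < l ∧ μ < √2 - 1)) : Separated l μ := by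
  have hs1 := lt_sqrt_two
  have hs2 := sqrt_two_lt
  have hss := sqrt_two_sq
  rcases hl with hl | ⟨hl, hμ⟩
  · refine separated_of h0 h1 ?_ ?_ (fun _ => ?_) ?_ (fun _ => ?_) <;> rw [lt_abs] <;> right <;>
      nlinarith
  · refine separated_of h0 h1 ?_ ?_ (fun _ => ?_) ?_ (fun _ => ?_) <;> rw [lt_abs] <;> left <;>
      nlinarith

theorem separated_dual {l μ : ℝ} (h0 : 0 < μ) (h1 : μ < 1)
    (hl : l < -1 ∨ √2 + 1 < l ∨ (l = √2 + 1 ∧ μ < √2 - 1)) : Separated l μ := by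
  have hs1 := lt_sqrt_two
  have hs2 := sqrt_two_lt
  have hss := sqrt_two_sq
  rcases hl with hl | hl | ⟨hl, hμ⟩
  · refine separated_of h0.le h1 ?_ ?_ (fun _ => ?_) ?_ (fun h => absurd h h0.ne') <;>
      rw [lt_abs] <;> right <;> nlinarith
  · refine separated_of h0.le h1 ?_ ?_ (fun _ => ?_) ?_ (fun h => absurd h h0.ne') <;>
      rw [lt_abs] <;> left <;> nlinarith
  · refine separated_of h0.le h1 ?_ ?_ (fun _ => ?_) ?_ (fun h => absurd h h0.ne') <;>
      rw [lt_abs] <;> left <;> nlinarith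

theorem one_div_sqrt_two : 1 / √2 = √2 / 2 := by
  have := sqrt_two_sq
  field_simp
  linarith

theorem cfSign_eq_neg_one {d : ℝ → ℤ} {x : ℝ} (h : cfSign d x = -1) : x - d x * √2 < 0 := by
  rcases lt_trichotomy (x - d x * √2) 0 with h' | h' | h'
  · exact h'
  · rw [cfSign, h', Real.sign_zero] at h
    norm_num at h
  · rw [cfSign, Real.sign_of_pos h'] at h
    norm_num at h

theorem int_le_of_lt {m n : ℤ} (h : (m : ℝ) - 1 < n) : (m : ℝ) ≤ n := by
  have : m - 1 < n := by exact_mod_cast h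
  have : m ≤ n := by omega
  exact_mod_cast this

theorem ne_sqrt_two_of_not_mem {x : ℝ} (hx : x ∉ QH4) : x ≠ √2 := by
  rintro h
  exact ne_int_mul_sqrt_two hx 1 (by rw [h]; simp)

theorem rosen_bounds {α : ℝ} (hα : α ∉ QH4) (i : ℕ) :
    0 ≤ cfDen rosenFirst α i ∧ cfDen rosenFirst α i < cfDen rosenFirst α (i + 1) ∧
    √2 < quotient rosenFirst α (i + 1) ∧
    (cfSign rosenFirst (quotient rosenFirst α i) = -1 →
      cfDen rosenFirst α i < (√2 - 1) * cfDen rosenFirst α (i + 1)) := by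
  have hs1 := lt_sqrt_two
  have hs2 := sqrt_two_lt
  have hss := sqrt_two_sq
  have hquot : ∀ i, √2 < quotient rosenFirst α (i + 1) := by
    intro i
    refine lt_of_le_of_ne ?_ (ne_sqrt_two_of_not_mem (quotient_not_mem hα (i + 1))).symm
    rw [quotient_succ, cfMap, le_one_div (by positivity)
      (abs_pos.2 (ne_int_mul_sqrt_two (quotient_not_mem hα i) _)), abs_le]
    have := (rosenFirst_eq_iff (quotient rosenFirst α i) _).1 rfl
    constructor <;> linarith
  induction i with
  | zero =>
    refine ⟨le_rfl, by simp [cfDen], hquot 0, fun _ => ?_⟩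
    simp only [cfDen]
    linarith
  | succ i ih =>
    obtain ⟨h0, h1, h2, h3⟩ := ih
    have ha := (rosenFirst_eq_iff (quotient rosenFirst α (i + 1)) _).1 rfl
    rw [one_div_sqrt_two] at ha
    have ha1 : (1 : ℤ) ≤ (rosenFirst (quotient rosenFirst α (i + 1)) : ℝ) :=
      int_le_of_lt (by push_cast; nlinarith)
    have hε := cfSign_sq (d := rosenFirst) (quotient_not_mem (d := rosenFirst) hα i)
    have hx := hquot (i + 1)
    have hneg := cfSign_eq_neg_one (d := rosenFirst) (x := quotient rosenFirst α (i + 1))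
    set x := quotient rosenFirst α (i + 1)
    set Q := cfDen rosenFirst α (i + 1)
    set Q' := cfDen rosenFirst α i
    have hQ : 0 < Q := h0.trans_lt h1
    have hrec : cfDen rosenFirst α (i + 1 + 1) =
      rosenFirst x * √2 * Q + cfSign rosenFirst (quotient rosenFirst α i) * Q' := rfl
    have hsQ : 0 < √2 * Q := by positivity
    push_cast at ha1
    have hx2 : x < rosenFirst x * √2 → 2 * (√2 * Q) ≤ rosenFirst x * √2 * Q := by
      intro hlt
      have : (2 : ℤ) ≤ (rosenFirst x : ℝ) := int_le_of_lt (by push_cast; nlinarith)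
      push_cast at this
      nlinarith
    have hx1 : √2 * Q ≤ rosenFirst x * √2 * Q := by nlinarith
    refine ⟨hQ.le, ?_, hx, fun hs => ?_⟩
    · rw [hrec]
      rcases hε with hε | hε <;> rw [hε]
      · nlinarith
      · have := h3 hε
        nlinarith
    · have := hx2 (by linarith [hneg hs])
      have key : (√2 + 1) * Q < cfDen rosenFirst α (i + 1 + 1) := by
        rw [hrec]
        rcases hε with hε | hε <;> rw [hε]
        · nlinarith
        · have := h3 hε
          nlinarith
      nlinarith

theorem dual_bounds {α : ℝ} (hα : α ∉ QH4) (i : ℕ) :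
    0 ≤ cfDen dualFirst α i ∧ cfDen dualFirst α i < cfDen dualFirst α (i + 1) ∧
    1 < quotient dualFirst α (i + 1) ∧
    (cfSign dualFirst (quotient dualFirst α i) = -1 →
      √2 + 1 < quotient dualFirst α (i + 1) ∨ (quotient dualFirst α (i + 1) = √2 + 1 ∧
        cfDen dualFirst α i < (√2 - 1) * cfDen dualFirst α (i + 1))) := by
  have hs1 := lt_sqrt_two
  have hs2 := sqrt_two_lt
  have hss := sqrt_two_sq
  have ht : ∀ i, 0 < |quotient dualFirst α i - dualFirst (quotient dualFirst α i) * √2| :=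
    fun i => abs_pos.2 (ne_int_mul_sqrt_two (quotient_not_mem hα i) _)
  have hquot : ∀ i, 1 < quotient dualFirst α (i + 1) := by
    intro i
    rw [quotient_succ, cfMap, lt_one_div one_pos (ht i), abs_lt]
    have := (dualFirst_eq_iff (quotient dualFirst α i) _).1 rfl
    constructor <;> linarith
  have hquot2 : ∀ i, cfSign dualFirst (quotient dualFirst α i) = -1 →
      √2 + 1 < quotient dualFirst α (i + 1) ∨ (quotient dualFirst α (i + 1) = √2 + 1 ∧
        quotient dualFirst α i = (dualFirst (quotient dualFirst α i) - 1) * √2 + 1) := by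
    intro i hi
    have h1 := (dualFirst_eq_iff (quotient dualFirst α i) _).1 rfl
    have h2 := cfSign_eq_neg_one hi
    have hpos := ht i
    rw [quotient_succ, cfMap]
    rw [abs_of_neg h2] at hpos ⊢
    rcases h1.1.lt_or_eq with h3 | h3
    · left
      rw [lt_div_iff₀ hpos]
      nlinarith
    · right
      refine ⟨?_, h3.symm⟩
      rw [div_eq_iff hpos.ne']
      nlinarith
  induction i with
  | zero =>
    refine ⟨le_rfl, by simp [cfDen], hquot 0, fun h => (hquot2 0 h).imp_right fun h' =>
      ⟨h'.1, ?_⟩⟩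
    simp only [cfDen]
    linarith
  | succ i ih =>
    obtain ⟨h0, h1, h2, h3⟩ := ih
    have ha := (dualFirst_eq_iff (quotient dualFirst α (i + 1)) _).1 rfl
    have ha1 : (1 : ℤ) ≤ (dualFirst (quotient dualFirst α (i + 1)) : ℝ) :=
      int_le_of_lt (by push_cast; nlinarith)
    have hε := cfSign_sq (d := dualFirst) (quotient_not_mem (d := dualFirst) hα i)
    have hx := hquot (i + 1)
    have hneg := hquot2 (i + 1)
    set x := quotient dualFirst α (i + 1)
    set Q := cfDen dualFirst α (i + 1)
    set Q' := cfDen dualFirst α i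
    have hQ : 0 < Q := h0.trans_lt h1
    have hrec : cfDen dualFirst α (i + 1 + 1) =
      dualFirst x * √2 * Q + cfSign dualFirst (quotient dualFirst α i) * Q' := rfl
    have hsQ : 0 < √2 * Q := by positivity
    push_cast at ha1
    have hx2 : √2 + 1 ≤ x → 2 * (√2 * Q) ≤ dualFirst x * √2 * Q := by
      intro hlt
      have : (2 : ℤ) ≤ (dualFirst x : ℝ) := int_le_of_lt (by push_cast; nlinarith)
      push_cast at this
      nlinarith
    have hx1 : √2 * Q ≤ dualFirst x * √2 * Q := by nlinarith
    refine ⟨hQ.le, ?_, hx, fun hs => (hneg hs).imp_right fun h' => ⟨h'.1, ?_⟩⟩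
    · rw [hrec]
      rcases hε with hε | hε <;> rw [hε]
      · nlinarith
      · have := hx2 (by rcases h3 hε with h | h <;> linarith)
        nlinarith
    · have ha2 : (2 : ℤ) ≤ (dualFirst x : ℝ) := int_le_of_lt (by push_cast; nlinarith)
      push_cast at ha2
      have key : (√2 + 1) * Q < cfDen dualFirst α (i + 1 + 1) := by
        rw [hrec]
        rcases hε with hε | hε <;> rw [hε]
        · nlinarith
        · rcases h3 hε with h | ⟨-, h⟩
          · have ha3 : (3 : ℤ) ≤ (dualFirst x : ℝ) := int_le_of_lt (by push_cast; nlinarith)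
            push_cast at ha3
            nlinarith
          · nlinarith
      nlinarith

theorem isBestApprox_rosen {α : ℝ} (hα : α ∉ QH4) (i : ℕ) :
    IsBestApprox α (cfNum rosenFirst α (i + 1)) (cfDen rosenFirst α (i + 1)) := by
  obtain ⟨hn, hL⟩ := convergent_neighbors (d := rosenFirst) hα i
  obtain ⟨h0, h1, h2, h3⟩ := rosen_bounds hα i
  have hq := h0.trans_lt h1
  have hs2 := sqrt_two_lt
  refine isBestApprox_of_separated hn hq (hn.isColumn.form_ne_zero hα)
    (div_mul_cancel₀ _ hq.ne').symm
    (l := -cfSign rosenFirst (quotient rosenFirst α i) * quotient rosenFirst α (i + 1)) ?_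
    (separated_rosen (by positivity) ((div_lt_one hq).2 h1) ?_) <;>
  rcases cfSign_sq (d := rosenFirst) (quotient_not_mem (d := rosenFirst) hα i) with hε | hε
  · rw [hε] at hL ⊢; linarith
  · rw [hε] at hL ⊢; linarith
  · left; rw [hε]; linarith
  · right; rw [div_lt_iff₀ hq]
    exact ⟨by rw [hε]; linarith, h3 hε⟩

theorem isBestApprox_dual {α : ℝ} (hα : α ∉ QH4) (i : ℕ) :
    IsBestApprox α (cfNum dualFirst α (i + 2)) (cfDen dualFirst α (i + 2)) := by
  obtain ⟨hn, hL⟩ := convergent_neighbors (d := dualFirst) hα (i + 1)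
  obtain ⟨h0, h1, h2, h3⟩ := dual_bounds hα (i + 1)
  have hq := h0.trans_lt h1
  have hq' : 0 < cfDen dualFirst α (i + 1) := (dual_bounds hα i).1.trans_lt (dual_bounds hα i).2.1
  refine isBestApprox_of_separated hn hq (hn.isColumn.form_ne_zero hα)
    (div_mul_cancel₀ _ hq.ne').symm
    (l := -cfSign dualFirst (quotient dualFirst α (i + 1)) * quotient dualFirst α (i + 1 + 1)) ?_
    (separated_dual (by positivity) ((div_lt_one hq).2 h1) ?_) <;>
  rcases cfSign_sq (d := dualFirst) (quotient_not_mem (d := dualFirst) hα (i + 1)) with hε | hε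
  · rw [hε] at hL ⊢; linarith
  · rw [hε] at hL ⊢; linarith
  · left; rw [hε]; linarith
  · right
    rw [div_lt_iff₀ hq, hε, neg_neg, one_mul]
    exact h3 hε

theorem next_convergent {d : ℝ → ℤ} {α p q ρ : ℝ} (hα : α ∉ QH4) (i : ℕ)
    (h : Neighbors p q (cfNum d α (i + 1)) (cfDen d α (i + 1))) (hq : 0 < q)
    (h0 : 0 ≤ cfDen d α i) (h1 : cfDen d α i < cfDen d α (i + 1))
    (hρ : q * α - p = ρ * (cfDen d α (i + 1) * α - cfNum d α (i + 1)))
    (hρx : ρ < quotient d α (i + 1))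
    (hd : ∀ n : ℤ, ρ = n * √2 - quotient d α (i + 1) → d (quotient d α (i + 1)) = n) :
    p = cfNum d α (i + 2) ∧ q = cfDen d α (i + 2) := by
  obtain ⟨hn, hL⟩ := convergent_neighbors (d := d) hα i
  have hs1 := lt_sqrt_two
  have hL0 := hn.isColumn.form_ne_zero hα
  obtain ⟨n, hpq⟩ := hn.unique h.swap
  have hε := cfSign_sq (d := d) (quotient_not_mem (d := d) hα i)
  have hcase : ∃ n : ℤ, (p = n * √2 * cfNum d α (i + 1) +
        cfSign d (quotient d α i) * cfNum d α i ∧ q = n * √2 * cfDen d α (i + 1) +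
        cfSign d (quotient d α i) * cfDen d α i) ∨
      (p = -(n * √2 * cfNum d α (i + 1) + cfSign d (quotient d α i) * cfNum d α i) ∧
        q = -(n * √2 * cfDen d α (i + 1) + cfSign d (quotient d α i) * cfDen d α i)) := by
    rcases hε with hε | hε <;> rw [hε] <;> rcases hpq with ⟨hp, hq⟩ | ⟨hp, hq⟩
    · exact ⟨n, Or.inl ⟨by rw [hp]; ring, by rw [hq]; ring⟩⟩
    · exact ⟨n, Or.inr ⟨by rw [hp]; ring, by rw [hq]; ring⟩⟩
    · exact ⟨-n, Or.inr ⟨by rw [hp]; push_cast; ring, by rw [hq]; push_cast; ring⟩⟩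
    · exact ⟨-n, Or.inl ⟨by rw [hp]; push_cast; ring, by rw [hq]; push_cast; ring⟩⟩
  obtain ⟨n, ⟨hp, hq'⟩ | ⟨hp, hq'⟩⟩ := hcase
  · have e : ρ = n * √2 - quotient d α (i + 1) := by
      refine mul_right_cancel₀ hL0 ?_
      rw [← hρ, hp, hq']
      linear_combination hL
    rw [cfNum, cfDen, hd n e]
    exact ⟨hp, hq'⟩
  · exfalso
    have e : ρ = -(n * √2 - quotient d α (i + 1)) := by
      refine mul_right_cancel₀ hL0 ?_
      rw [← hρ, hp, hq']
      linear_combination -hL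
    have hn0 : (1 : ℤ) ≤ (n : ℝ) := int_le_of_lt (by push_cast; nlinarith)
    push_cast at hn0
    have h2 : 1 * cfDen d α (i + 1) ≤ n * √2 * cfDen d α (i + 1) :=
      mul_le_mul_of_nonneg_right (by nlinarith) (h0.trans h1.le)
    rcases hε with hε | hε <;> rw [hε] at hq' <;> linarith

theorem sq_lt_of_den_lt {p q p' q' : ℝ} (h : IsColumn p q) (h' : IsColumn p' q') (h0 : 0 ≤ q')
    (hlt : q' < q) {N : ℕ} (hN : q ^ 2 < (N + 1 : ℕ)) : q' ^ 2 < N := by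
  obtain ⟨k, hk⟩ := h.sq_nat
  obtain ⟨k', hk'⟩ := h'.sq_nat
  have h1 : q' ^ 2 < q ^ 2 := by nlinarith
  rw [hk, hk'] at h1
  rw [hk] at hN
  rw [hk']
  norm_cast at *
  omega

theorem neighbors_prev {p q p' q' : ℝ} (h : Neighbors p q p' q') (n : ℤ) :
    Neighbors p' q' (n * √2 * p' - p) (n * √2 * q' - q) := by
  convert (h.swap.neg_right.shear n) using 1 <;> ring

theorem exists_rosen {α : ℝ} (hα : α ∉ QH4) (N : ℕ) : ∀ {p q p' q' ρ : ℝ},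
    Neighbors p q p' q' → q ^ 2 < N → 0 ≤ q' → q' < q →
    q * α - p = ρ * (q' * α - p') → -(√2 / 2) < ρ → ρ < √2 / 2 →
    (0 < ρ → q' < (√2 - 1) * q) →
    ∃ i, p = cfNum rosenFirst α (i + 1) ∧ q = cfDen rosenFirst α (i + 1) := by
  have hs1 := lt_sqrt_two
  have hs2 := sqrt_two_lt
  have hss := sqrt_two_sq
  induction N with
  | zero =>
    intro p q p' q' ρ _ h
    have := sq_nonneg q
    push_cast at h
    linarith
  | succ N ih =>
    intro p q p' q' ρ h hN h0 hlt hρ hρ1 hρ2 hρ3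
    have hq : 0 < q := h0.trans_lt hlt
    have hL := h.isColumn.form_ne_zero hα
    have hρ0 : ρ ≠ 0 := by
      rintro rfl
      exact hL (by rw [hρ, zero_mul])
    rcases h0.eq_or_lt with hq0 | hq0
    · obtain ⟨rfl, hp', m, rfl⟩ := h.den_eq_zero hq hq0.symm
      subst hq0
      have : rosenFirst α = m := by
        rw [rosenFirst_eq_iff, one_div_sqrt_two]
        rcases hp' with rfl | rfl <;> constructor <;> linarith
      exact ⟨0, by rw [cfNum, this], rfl⟩
    · set n := ⌈(q / q' - 1) / √2⌉ with hn
      have hn1 : q ≤ (n * √2 + 1) * q' := by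
        have := Int.le_ceil ((q / q' - 1) / √2)
        rw [← hn, div_le_iff₀ (by positivity), sub_le_iff_le_add, div_le_iff₀ hq0] at this
        exact this
      have hn2 : ((n - 1) * √2 + 1) * q' < q := by
        have := Int.ceil_lt_add_one ((q / q' - 1) / √2)
        rw [← hn, ← sub_lt_iff_lt_add, lt_div_iff₀ (by positivity), lt_sub_iff_add_lt,
          lt_div_iff₀ hq0] at this
        exact this
      have hn0 : (1 : ℤ) ≤ (n : ℝ) := int_le_of_lt (by
        push_cast
        by_contra! hh
        have : (n : ℝ) * √2 ≤ 0 := by nlinarith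
        nlinarith)
      push_cast at hn0
      have hden : √2 < n * √2 - ρ := by
        rcases hρ0.lt_or_gt with h' | h'
        · nlinarith
        · have h5 := hρ3 h'
          have hn3 : (2 : ℤ) ≤ (n : ℝ) := int_le_of_lt (by
            push_cast
            by_contra! hh
            have h6 : n = 1 := by
              have : (n : ℝ) ≤ (1 : ℤ) := by push_cast; linarith
              have h7 : n ≤ 1 := by exact_mod_cast this
              have h8 : 1 ≤ n := by exact_mod_cast hn0
              omega
            rw [h6] at hn1
            push_cast at hn1
            nlinarith)
          push_cast at hn3
          nlinarith
      have hprev := neighbors_prev h n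
      have hdenpos : 0 < n * √2 - ρ := by linarith
      have hρ' : q' * α - p' =
          1 / (n * √2 - ρ) * ((n * √2 * q' - q) * α - (n * √2 * p' - p)) := by
        have e : (n * √2 * q' - q) * α - (n * √2 * p' - p) =
          (n * √2 - ρ) * (q' * α - p') := by linear_combination -hρ
        rw [e]
        field_simp
      have hb0 : 0 < 1 / (n * √2 - ρ) := by positivity
      have hb1 : 1 / (n * √2 - ρ) < √2 / 2 := by
        rw [div_lt_iff₀ hdenpos]
        nlinarith
      have hN' := sq_lt_of_den_lt h.isColumn h.swap.isColumn h0 hlt hN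
      have hexists : ∃ i, p' = cfNum rosenFirst α (i + 1) ∧ q' = cfDen rosenFirst α (i + 1) := by
        rcases le_or_gt 0 (n * √2 * q' - q) with hc | hc
        · exact ih hprev hN' hc (by nlinarith) hρ' (by linarith) hb1 (fun _ => by nlinarith)
        · refine ih (ρ := -(1 / (n * √2 - ρ))) hprev.neg_right hN' (by linarith)
            (lt_of_le_of_ne (by nlinarith) hprev.neg_right.den_ne.symm) (by rw [hρ']; ring)
            (by linarith) (by linarith) (fun h => by linarith)
      obtain ⟨i, rfl, rfl⟩ := hexists
      obtain ⟨b0, b1, b2, -⟩ := rosen_bounds hα i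
      refine ⟨i + 1, next_convergent hα i h hq b0 b1 hρ (by linarith) fun m hm => ?_⟩
      rw [rosenFirst_eq_iff, one_div_sqrt_two]
      constructor <;> linarith

theorem dual_first_convergent {α p q p' p'' ρ : ℝ} (hα : α ∉ QH4) {m n : ℤ}
    (h : Neighbors p q p' 1) (hp' : p' = m * √2) (hp'' : p'' = 1 ∨ p'' = -1)
    (hp : p = n * √2 * p' - p'') (hq : q = n * √2) (hn : 1 ≤ n)
    (hρ : q * α - p = ρ * (α - p')) (hρ1 : -1 < ρ) (hρ2 : ρ < √2 - 1) :
    p = cfNum dualFirst α 2 ∧ q = cfDen dualFirst α 2 := by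
  have hs1 := lt_sqrt_two
  have hs2 := sqrt_two_lt
  have hss := sqrt_two_sq
  have hn1 : (1 : ℝ) ≤ n := by exact_mod_cast hn
  have hdenpos : 1 < n * √2 - ρ := by nlinarith
  have e : (n * √2 - ρ) * (α - m * √2) = -p'' := by
    rw [hp, hq, hp'] at hρ
    linear_combination hρ
  have base : dualFirst α = m → p = cfNum dualFirst α 2 ∧ q = cfDen dualFirst α 2 := by
    intro hm
    obtain ⟨b0, b1, b2, -⟩ := dual_bounds hα 0
    have e1 : cfNum dualFirst α (0 + 1) = p' := by rw [cfNum, hm, hp']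
    have e2 : cfDen dualFirst α (0 + 1) = 1 := rfl
    refine next_convergent (ρ := ρ) hα 0 (by rwa [e1, e2]) (by rw [hq]; positivity) b0 b1
      (by rw [e1, e2, one_mul]; exact hρ) (by linarith) fun k hk => ?_
    rw [dualFirst_eq_iff]
    constructor <;> linarith
  rcases hp'' with rfl | rfl
  · rcases hn.eq_or_lt with rfl | hn2
    · have hk : dualFirst α = m - 1 := by
        rw [dualFirst_eq_iff]
        push_cast at e hdenpos ⊢
        constructor <;> nlinarith
      have ht0 : 0 < α - (dualFirst α : ℤ) * √2 := by
        rw [hk]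
        push_cast at e hdenpos ⊢
        nlinarith
      have ht1 : √2 - 1 < α - (dualFirst α : ℤ) * √2 := by
        rw [hk]
        push_cast at e hdenpos ⊢
        nlinarith
      have ht2 : α - (dualFirst α : ℤ) * √2 < 1 := by
        have := (dualFirst_eq_iff α _).1 rfl
        linarith
      have hx : dualFirst (quotient dualFirst α 1) = 1 := by
        rw [quotient_succ, cfMap, dualFirst_eq_iff]
        simp only [quotient, Function.iterate_zero, id]
        rw [abs_of_pos ht0, le_div_iff₀ ht0, div_lt_iff₀ ht0]
        push_cast
        constructor <;> nlinarith
      have hsgn : cfSign dualFirst (quotient dualFirst α 0) = 1 := Real.sign_of_pos ht0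
      rw [cfNum, cfDen, zero_add, hx, hsgn, cfNum, cfDen, cfNum, cfDen, hk, hp, hq, hp']
      push_cast
      constructor
      · linear_combination hss
      · ring
    · refine base ?_
      have hn2 : (2 : ℝ) ≤ n := by exact_mod_cast hn2
      have hd2 : √2 + 1 < n * √2 - ρ := by nlinarith
      rw [dualFirst_eq_iff]
      constructor <;> nlinarith
  · refine base ?_
    rw [dualFirst_eq_iff]
    constructor <;> nlinarith

theorem exists_dual {α : ℝ} (hα : α ∉ QH4) (N : ℕ) : ∀ {p q p' q' ρ : ℝ},
    Neighbors p q p' q' → q ^ 2 < N → 0 < q' → √2 * q' ≤ q →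
    q * α - p = ρ * (q' * α - p') → -1 < ρ → ρ < √2 - 1 →
    ∃ i, p = cfNum dualFirst α (i + 2) ∧ q = cfDen dualFirst α (i + 2) := by
  have hs1 := lt_sqrt_two
  have hs2 := sqrt_two_lt
  have hss := sqrt_two_sq
  induction N with
  | zero =>
    intro p q p' q' ρ _ h
    have := sq_nonneg q
    push_cast at h
    linarith
  | succ N ih =>
    intro p q p' q' ρ h hN hq0 hle hρ hρ1 hρ2
    have hlt : q' < q := by nlinarith
    have hq : 0 < q := hq0.trans hlt
    obtain ⟨n, hn⟩ : ∃ n : ℤ, rosenFirst (q / q') = n := ⟨_, rfl⟩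
    rw [rosenFirst_eq_iff, one_div_sqrt_two, div_lt_iff₀ hq0, le_div_iff₀ hq0] at hn
    obtain ⟨hn1, hn2⟩ := hn
    have hn0 : (1 : ℤ) ≤ (n : ℝ) := int_le_of_lt (by
      push_cast
      by_contra! hh
      have : (n : ℝ) * √2 ≤ 0 := by nlinarith
      nlinarith)
    have hn0' : 1 ≤ n := by exact_mod_cast hn0
    push_cast at hn0
    have hden : 1 < n * √2 - ρ := by nlinarith
    have hprev := neighbors_prev h n
    have hdenpos : 0 < n * √2 - ρ := by linarith
    have hρ' : q' * α - p' =
        1 / (n * √2 - ρ) * ((n * √2 * q' - q) * α - (n * √2 * p' - p)) := by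
      have e : (n * √2 * q' - q) * α - (n * √2 * p' - p) =
        (n * √2 - ρ) * (q' * α - p') := by linear_combination -hρ
      rw [e]
      field_simp
    have hb0 : 0 < 1 / (n * √2 - ρ) := by positivity
    have hb1 : 1 / (n * √2 - ρ) < 1 := by
      rw [div_lt_iff₀ hdenpos]
      linarith
    have hN' := sq_lt_of_den_lt h.isColumn h.swap.isColumn hq0.le hlt hN
    have step : (∃ i, p' = cfNum dualFirst α (i + 2) ∧ q' = cfDen dualFirst α (i + 2)) →
        ∃ i, p = cfNum dualFirst α (i + 2) ∧ q = cfDen dualFirst α (i + 2) := by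
      rintro ⟨i, rfl, rfl⟩
      obtain ⟨b0, b1, b2, -⟩ := dual_bounds hα (i + 1)
      refine ⟨i + 1, next_convergent hα (i + 1) h hq b0 b1 hρ (by linarith) fun m hm => ?_⟩
      rw [dualFirst_eq_iff]
      constructor <;> linarith
    rcases lt_trichotomy (n * √2 * q' - q) 0 with hc | hc | hc
    · exact step (ih (ρ := -(1 / (n * √2 - ρ))) hprev.neg_right hN' (by linarith)
        (by nlinarith) (by rw [hρ']; ring) (by linarith) (by linarith))
    · obtain ⟨rfl, hp'', m, hp'⟩ := hprev.den_eq_zero hq0 hc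
      exact ⟨0, dual_first_convergent hα h hp' hp'' (by ring) (by linarith) hn0'
        (by rw [hρ, one_mul]) hρ1 hρ2⟩
    · have hn3 : (2 : ℤ) ≤ (n : ℝ) := int_le_of_lt (by
        push_cast
        have h1 : √2 * q' < n * √2 * q' := by linarith
        have h2 : √2 < n * √2 := lt_of_mul_lt_mul_right h1 hq0.le
        have h3 : 1 < (n : ℝ) := by nlinarith
        linarith)
      push_cast at hn3
      refine step (ih hprev hN' hc (by nlinarith) hρ' (by linarith) ?_)
      rw [div_lt_iff₀ hdenpos]
      nlinarith

theorem IsBestApprox.lt_of_det {α p q r s : ℝ} (h : IsBestApprox α p q) (hrs : IsColumn r s)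
    (hs : 0 < s) (hsq : s ≤ q) (hdet : p * s - r * q ≠ 0) : |q * α - p| < |s * α - r| := by
  refine h.2 r s ⟨hs, hrs⟩ (fun e => hdet ?_) hsq
  rw [div_eq_div_iff hs.ne' h.1.1.ne'] at e
  linarith

theorem IsBestApprox.exists_convergent {α p q : ℝ} (hα : α ∉ QH4) (h : IsBestApprox α p q) :
    (∃ i, p = cfNum rosenFirst α (i + 1) ∧ q = cfDen rosenFirst α (i + 1)) ∨
    (∃ i, p = cfNum dualFirst α (i + 2) ∧ q = cfDen dualFirst α (i + 2)) := by
  have hs1 := lt_sqrt_two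
  have hs2 := sqrt_two_lt
  have hss := sqrt_two_sq
  have hq : 0 < q := h.1.1
  obtain ⟨p', q', hn, h0, h1⟩ :
      ∃ p' q', Neighbors p q p' q' ∧ 0 ≤ q' ∧ √2 * q' ≤ q := by
    obtain ⟨p', q', hn⟩ := IsColumn.exists_neighbors (p := p) (q := q) h.1.2
    obtain ⟨n, hn'⟩ : ∃ n : ℤ, rosenFirst (q' / q) = n := ⟨_, rfl⟩
    rw [rosenFirst_eq_iff, one_div_sqrt_two, div_lt_iff₀ hq, le_div_iff₀ hq] at hn'
    have hsh := hn.shear (-n)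
    push_cast at hsh
    rcases le_total 0 (q' + -n * √2 * q) with hc | hc
    · exact ⟨_, _, hsh, hc, by nlinarith⟩
    · exact ⟨_, _, hsh.neg_right, by linarith, by nlinarith⟩
  have hlt : q' < q := by nlinarith
  have hL := hn.isColumn.form_ne_zero hα
  have hL' := hn.swap.isColumn.form_ne_zero hα
  obtain ⟨l, hl⟩ : ∃ l, q' * α - p' = l * (q * α - p) := ⟨_, (div_mul_cancel₀ _ hL).symm⟩
  have hdet := hn.det_ne_zero
  have hl0 : l ≠ 0 := by
    rintro rfl
    exact hL' (by rw [hl, zero_mul])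
  have hρ : q * α - p = 1 / l * (q' * α - p') := by rw [hl]; field_simp
  obtain ⟨N, hN⟩ := exists_nat_gt (q ^ 2)
  have scale : ∀ c : ℝ, |q * α - p| < |c * (q * α - p)| → 1 < |c| := by
    intro c hc
    rw [abs_mul] at hc
    have := abs_pos.2 hL
    by_contra! hh
    nlinarith
  have c1 : 0 < q' → 1 < |l| := fun hq' =>
    scale _ (hl ▸ h.lt_of_det hn.swap.isColumn hq' hlt.le hdet)
  have c2 : (√2 - 1) * q ≤ q' → 1 < |√2 - l| := fun hq' => by
    have hc : IsColumn (p * √2 - p') (q * √2 - q') := by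
      convert (hn.neg_right.shear 1).swap.isColumn using 1 <;> push_cast <;> ring
    have := h.lt_of_det hc (by nlinarith) (by nlinarith)
      (fun e => hdet (by linear_combination -e))
    refine scale _ (lt_of_lt_of_eq this (congrArg _ ?_))
    linear_combination -hl
  have c3 : ∀ n : ℤ, n ^ 2 = 1 → 0 < q + n * √2 * q' → q + n * √2 * q' ≤ q →
      1 < |1 + n * √2 * l| := fun n hnn h2 h3 => by
    have := h.lt_of_det (hn.swap.shear n).swap.isColumn h2 h3 (fun e => by
      have e' : n * √2 * (p * q' - p' * q) = 0 := by linear_combination e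
      have : (n : ℝ) ≠ 0 := by
        rintro h4
        have : n = 0 := by exact_mod_cast h4
        simp [this] at hnn
      exact mul_ne_zero (mul_ne_zero this (by positivity)) hdet e')
    refine scale _ (lt_of_lt_of_eq this (congrArg _ ?_))
    linear_combination n * √2 * hl
  have inv_neg : ∀ c : ℝ, 0 < c → l < -c → -(1 / c) < 1 / l ∧ 1 / l < 0 := fun c hc hlc => by
    have : 0 < -l := by linarith
    have e : 1 / l = -(1 / -l) := by rw [div_neg, neg_neg]
    have := one_div_lt_one_div_of_lt hc (by linarith : c < -l)
    have : 0 < 1 / -l := by positivity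
    rw [e]
    constructor <;> linarith
  have inv_pos : ∀ c : ℝ, 0 < c → c < l → 0 < 1 / l ∧ 1 / l < 1 / c := fun c hc hlc =>
    ⟨one_div_pos.2 (hc.trans hlc), one_div_lt_one_div_of_lt hc hlc⟩
  have hpos2 : (0 : ℝ) < √2 := by positivity
  have dual_of : 0 < q' → (l < -1 ∨ √2 + 1 < l) →
      ∃ i, p = cfNum dualFirst α (i + 2) ∧ q = cfDen dualFirst α (i + 2) := by
    intro hq' hc
    rcases hc with hc | hc
    · have := inv_neg 1 one_pos hc
      exact exists_dual hα N hn hN hq' h1 hρ (by linarith) (by linarith)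
    · have := inv_pos _ (by positivity) hc
      have e : 1 / (√2 + 1) = √2 - 1 := by
        rw [div_eq_iff (by positivity)]
        linarith
      exact exists_dual hα N hn hN hq' h1 hρ (by linarith) (by linarith)
  have rosen_neg : l < -√2 →
      ∃ i, p = cfNum rosenFirst α (i + 1) ∧ q = cfDen rosenFirst α (i + 1) := by
    intro hc
    have := inv_neg _ hpos2 hc
    rw [one_div_sqrt_two] at this
    exact exists_rosen hα N hn hN h0 hlt hρ (by linarith) (by linarith) (fun h => by linarith)
  have rosen_pos : √2 < l → q' < (√2 - 1) * q →
      ∃ i, p = cfNum rosenFirst α (i + 1) ∧ q = cfDen rosenFirst α (i + 1) := by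
    intro hc hq'
    have := inv_pos _ hpos2 hc
    rw [one_div_sqrt_two] at this
    exact exists_rosen hα N hn hN h0 hlt hρ (by linarith) (by linarith) (fun _ => hq')
  rcases h0.eq_or_lt with hz | hq'
  · left
    have k1 := c3 1 (by norm_num) (by rw [← hz]; simpa) (by rw [← hz]; simp)
    have k2 := c3 (-1) (by norm_num) (by rw [← hz]; simpa) (by rw [← hz]; simp)
    push_cast at k1 k2
    rw [lt_abs] at k1 k2
    rcases k1 with k1 | k1 <;> rcases k2 with k2 | k2
    · nlinarith
    · exact rosen_pos (by nlinarith) (by rw [← hz]; nlinarith)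
    · exact rosen_neg (by nlinarith)
    · nlinarith
  · have k1 := c1 hq'
    rw [lt_abs] at k1
    rcases k1 with k1 | k1
    swap
    · exact Or.inr (dual_of hq' (Or.inl (by linarith)))
    rcases le_or_gt ((√2 - 1) * q) q' with hc | hc
    · have k2 := c2 hc
      rw [lt_abs] at k2
      rcases k2 with k2 | k2
      · linarith
      · exact Or.inr (dual_of hq' (Or.inr (by linarith)))
    · have k2 := c3 (-1) (by norm_num) (by push_cast; nlinarith) (by push_cast; nlinarith)
      push_cast at k2
      rw [lt_abs] at k2
      rcases k2 with k2 | k2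
      · nlinarith
      · exact Or.inl (rosen_pos (by nlinarith) hc)

theorem rosenConvergent_eq {α : ℝ} (hα : α ∉ QH4) (i : ℕ) :
    rosenConvergent α i = cfNum rosenFirst α (i + 1) / cfDen rosenFirst α (i + 1) :=
  finiteCF_eq (d := rosenFirst) (fun _ hβ j =>
    (rosen_bounds hβ j).1.trans_lt (rosen_bounds hβ j).2.1) i α hα

theorem dualConvergent_eq {α : ℝ} (hα : α ∉ QH4) (i : ℕ) :
    dualConvergent α i = cfNum dualFirst α (i + 1) / cfDen dualFirst α (i + 1) :=
  finiteCF_eq (d := dualFirst) (fun _ hβ j =>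
    (dual_bounds hβ j).1.trans_lt (dual_bounds hβ j).2.1) i α hα

end Hecke4

theorem theorem1p3 (α : ℝ) (hα : α ∉ Hecke4.QH4) (p q : ℝ) (hpq : Hecke4.IsFraction p q) :
    Hecke4.IsBestApprox α p q ↔
      (∃ i : ℕ, p / q = Hecke4.rosenConvergent α i) ∨
        (∃ i : ℕ, 1 ≤ i ∧ p / q = Hecke4.dualConvergent α i) := by
  constructor
  · intro h
    rcases h.exists_convergent hα with ⟨i, rfl, rfl⟩ | ⟨i, rfl, rfl⟩
    · exact Or.inl ⟨i, (Hecke4.rosenConvergent_eq hα i).symm⟩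
    · exact Or.inr ⟨i + 1, by omega, (Hecke4.dualConvergent_eq hα (i + 1)).symm⟩
  · rintro (⟨i, hi⟩ | ⟨i, hi1, hi⟩)
    · have h := Hecke4.isBestApprox_rosen hα i
      rw [Hecke4.rosenConvergent_eq hα] at hi
      obtain ⟨rfl, rfl⟩ := hpq.unique h.1 hi
      exact h
    · obtain ⟨j, rfl⟩ : ∃ j, i = j + 1 := ⟨i - 1, by omega⟩
      have h := Hecke4.isBestApprox_dual hα j
      rw [Hecke4.dualConvergent_eq hα] at hi
      obtain ⟨rfl, rfl⟩ := hpq.unique h.1 hi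
      exact h
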